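/- Let $\mathbb D=\{z\in\mathbb C:|z|<1\}$, let $L^2_a$ be the Bergman space of $\mathbb D$, i.e. the space of holomorphic functions on $\mathbb D$ that are square integrable with respect to area measure, with the $L^2$ norm, and for a bounded linear operator $A$ on $L^2_a$ let $$\mathrm{Ext}(A)=\{\lambda\in\mathbb C : AX=\lambda XA \text{ for some nonzero bounded linear operator } X \text{ on } L^2_a\}$$ be its extended spectrum. Let $0<r<1$ and let $\varphi(z)=\dfrac{z+r}{1+rz}$, a hyperbolic automorphism of $\mathbb D$. Then the composition operator $C_\varphi f=f\circ\varphi$ is a bounded linear operator on $L^2_a$, and $$\mathrm{Ext}(C_\varphi)=\mathbb T=\{\lambda\in\mathbb C:|\lambda|=1\}.$$ -/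

import Mathlib

open MeasureTheory Metric

/-- The area measure on the open unit disk `𝔻` of `ℂ`. -/
noncomputable def diskArea : Measure ℂ :=
  volume.restrict (ball (0 : ℂ) 1)

/-- The Bergman space `L²_a` of the unit disk: the subspace of `L²(𝔻, dA)` of the classes that
have a holomorphic representative, with the norm and inner product of `L²(𝔻, dA)`. -/
noncomputable def bergmanSpace : Submodule ℂ (Lp ℂ 2 diskArea) where
  carrier := {f | ∃ g : ℂ → ℂ, DifferentiableOn ℂ g (ball (0 : ℂ) 1) ∧ (f : ℂ → ℂ) =ᵐ[diskArea] g}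
  zero_mem' := ⟨0, differentiableOn_const 0, Lp.coeFn_zero ℂ 2 diskArea⟩
  add_mem' := by
    rintro f₁ f₂ ⟨g₁, hg₁, h₁⟩ ⟨g₂, hg₂, h₂⟩
    exact ⟨g₁ + g₂, hg₁.add hg₂, (Lp.coeFn_add f₁ f₂).trans (h₁.add h₂)⟩
  smul_mem' := by
    rintro c f ⟨g, hg, h⟩
    exact ⟨c • g, hg.const_smul c, (Lp.coeFn_smul c f).trans (h.const_smul c)⟩

/-- `C` is the composition operator `C_φ f = f ∘ φ` on the Bergman space, `φ` being a holomorphic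
self-map of the disk; here `g` is the holomorphic representative of `f`. -/
def IsCompositionOperator (φ : ℂ → ℂ) (C : bergmanSpace →L[ℂ] bergmanSpace) : Prop :=
  DifferentiableOn ℂ φ (ball 0 1) ∧ Set.MapsTo φ (ball 0 1) (ball 0 1) ∧
    ∀ (f : bergmanSpace) (g : ℂ → ℂ), DifferentiableOn ℂ g (ball 0 1) →
      ((f : Lp ℂ 2 diskArea) : ℂ → ℂ) =ᵐ[diskArea] g →
        ((C f : Lp ℂ 2 diskArea) : ℂ → ℂ) =ᵐ[diskArea] fun z => g (φ z)

/-- The composition operator is determined by `φ`. -/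
theorem IsCompositionOperator.unique {φ : ℂ → ℂ} {C C' : bergmanSpace →L[ℂ] bergmanSpace}
    (h : IsCompositionOperator φ C) (h' : IsCompositionOperator φ C') : C = C' := by
  ext1 f
  obtain ⟨g, hg, hfg⟩ := f.2
  exact Subtype.ext (Lp.ext ((h.2.2 f g hg hfg).trans (h'.2.2 f g hg hfg).symm))

/-- The extended spectrum `Ext(A)` of a bounded operator `A`: the set of all complex `c` such that
`A X = c X A` for some nonzero bounded operator `X`. -/
def extendedSpectrum {H : Type*} [NormedAddCommGroup H] [NormedSpace ℂ H] (A : H →L[ℂ] H) : Set ℂ :=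
  {c | ∃ X : H →L[ℂ] H, X ≠ 0 ∧ A.comp X = c • X.comp A}

/-!
The automorphisms `z ↦ (z + tanh x) / (1 + z tanh x)` form a one-parameter group, so their
composition operators form a group `U x` (`hypComp`) on the Bergman space, and `C_φ = U x` with
`x = artanh r`.

If `‖c‖ ≠ 1` and `U x * X = c • X * U x`, then `U (n x) * X * U (-n x) = c ^ n • X` for every integer
`n`. A change of variables gives `‖U y‖ ≤ exp (2 |y|)`. On the other hand, for `f` of the form
`(1 - z ^ 2) ^ 2 * g` with `g` in the Bergman space, the zeros at the two fixed points `±1` cancel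
the poles of the Jacobian, and `‖U y f‖ ≤ 16 exp (-2 |y|) ‖g‖`
(`norm_hypComp_apply_le_of_vanishing`). The two rates compensate exactly, so `‖c‖ ^ n * ‖X f‖` is
bounded uniformly over all integers `n`, which forces `X f = 0`. Such `f` are dense
(`dense_setOf_norm_hypComp_le`), hence `X = 0` (`eq_zero_of_intertwining`).

If `‖c‖ = 1`, the function `h = ((1 + z) / (1 - z)) ^ (i θ)` is bounded, since
`(1 + z) / (1 - z)` maps the disk to the right half-plane, and `φ` becomes a dilation there, so
`h ∘ φ = c h` for a suitable `θ`. Multiplication by `h` is then an intertwining operator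
(`mem_extendedSpectrum_hypComp_of_norm_eq_one`).
-/

/-! ### Operators on the Bergman space -/

lemma eqOn_ball_of_ae_eq {g g' : ℂ → ℂ} (hg : DifferentiableOn ℂ g (ball 0 1))
    (hg' : DifferentiableOn ℂ g' (ball 0 1)) (h : g =ᵐ[diskArea] g') :
    Set.EqOn g g' (ball 0 1) :=
  Measure.eqOn_open_of_ae_eq h isOpen_ball hg.continuousOn hg'.continuousOn

lemma ae_diskArea_of_forall_mem_ball {p : ℂ → Prop} (h : ∀ z ∈ ball (0 : ℂ) 1, p z) :
    ∀ᵐ z ∂diskArea, p z :=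
  (ae_restrict_mem measurableSet_ball).mono h

lemma aestronglyMeasurable_diskArea {g : ℂ → ℂ} (hg : DifferentiableOn ℂ g (ball 0 1)) :
    AEStronglyMeasurable g diskArea :=
  hg.continuousOn.aestronglyMeasurable measurableSet_ball

lemma memLp_of_ae_eq {f : bergmanSpace} {g : ℂ → ℂ}
    (h : ((f : Lp ℂ 2 diskArea) : ℂ → ℂ) =ᵐ[diskArea] g) : MemLp g 2 diskArea :=
  (memLp_congr_ae h).1 (Lp.memLp _)

lemma enorm_eq_eLpNorm_of_ae_eq {f : bergmanSpace} {g : ℂ → ℂ}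
    (h : ((f : Lp ℂ 2 diskArea) : ℂ → ℂ) =ᵐ[diskArea] g) : ‖f‖ₑ = eLpNorm g 2 diskArea := by
  rw [← eLpNorm_congr_ae h, ← Lp.enorm_def]
  rfl

lemma norm_eq_eLpNorm_of_ae_eq {f : bergmanSpace} {g : ℂ → ℂ}
    (h : ((f : Lp ℂ 2 diskArea) : ℂ → ℂ) =ᵐ[diskArea] g) :
    ‖f‖ = (eLpNorm g 2 diskArea).toReal := by
  rw [← enorm_eq_eLpNorm_of_ae_eq h, toReal_enorm]

lemma bergman_ext {f f' : bergmanSpace} {g : ℂ → ℂ}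
    (h : ((f : Lp ℂ 2 diskArea) : ℂ → ℂ) =ᵐ[diskArea] g)
    (h' : ((f' : Lp ℂ 2 diskArea) : ℂ → ℂ) =ᵐ[diskArea] g) : f = f' :=
  Subtype.ext (Lp.ext (h.trans h'.symm))

/-- `W` is the weighted composition operator `f ↦ h · (f ∘ φ)` on the Bergman space, computed on
holomorphic representatives. Both composition operators (`h = 1`) and multiplication operators
(`φ = id`) have this form. -/
def IsWeightedComposition (h φ : ℂ → ℂ) (W : bergmanSpace →L[ℂ] bergmanSpace) : Prop :=
  ∀ (f : bergmanSpace) (g : ℂ → ℂ), DifferentiableOn ℂ g (ball 0 1) →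
    ((f : Lp ℂ 2 diskArea) : ℂ → ℂ) =ᵐ[diskArea] g →
      ((W f : Lp ℂ 2 diskArea) : ℂ → ℂ) =ᵐ[diskArea] fun z => h z * g (φ z)

/-- A weighted composition that is bounded for the `L²` seminorm on holomorphic functions defines
a bounded operator on the Bergman space. -/
theorem exists_isWeightedComposition {h φ : ℂ → ℂ} (hh : DifferentiableOn ℂ h (ball 0 1))
    (hφ : DifferentiableOn ℂ φ (ball 0 1)) (hmaps : Set.MapsTo φ (ball 0 1) (ball 0 1)) (K : ℝ)
    (hK : ∀ g : ℂ → ℂ, DifferentiableOn ℂ g (ball 0 1) →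
      eLpNorm (fun z => h z * g (φ z)) 2 diskArea ≤ ENNReal.ofReal K * eLpNorm g 2 diskArea) :
    ∃ W : bergmanSpace →L[ℂ] bergmanSpace, IsWeightedComposition h φ W := by
  have hdiff : ∀ g : ℂ → ℂ, DifferentiableOn ℂ g (ball 0 1) →
      DifferentiableOn ℂ (fun z => h z * g (φ z)) (ball 0 1) :=
    fun g hg => hh.mul (hg.comp hφ hmaps)
  have hex : ∀ f : bergmanSpace, ∃ w : bergmanSpace, ∀ g : ℂ → ℂ,
      DifferentiableOn ℂ g (ball 0 1) → ((f : Lp ℂ 2 diskArea) : ℂ → ℂ) =ᵐ[diskArea] g →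
        ((w : Lp ℂ 2 diskArea) : ℂ → ℂ) =ᵐ[diskArea] fun z => h z * g (φ z) := by
    intro f
    obtain ⟨g, hg, hfg⟩ := f.2
    have hmem : MemLp (fun z => h z * g (φ z)) 2 diskArea :=
      ⟨aestronglyMeasurable_diskArea (hdiff g hg), (hK g hg).trans_lt
        (ENNReal.mul_lt_top ENNReal.ofReal_lt_top (memLp_of_ae_eq hfg).2)⟩
    refine ⟨⟨hmem.toLp _, _, hdiff g hg, hmem.coeFn_toLp⟩, fun g' hg' hfg' => ?_⟩
    refine hmem.coeFn_toLp.trans (ae_diskArea_of_forall_mem_ball fun z hz => ?_)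
    have := eqOn_ball_of_ae_eq hg hg' (hfg.symm.trans hfg') (hmaps hz)
    simp only [this]
  choose T hT using hex
  let Tl : bergmanSpace →ₗ[ℂ] bergmanSpace :=
    { toFun := T
      map_add' := by
        intro f₁ f₂
        obtain ⟨g₁, hg₁, h₁⟩ := f₁.2
        obtain ⟨g₂, hg₂, h₂⟩ := f₂.2
        refine bergman_ext (hT _ (g₁ + g₂) (hg₁.add hg₂)
          ((Lp.coeFn_add _ _).trans (h₁.add h₂))) ?_
        refine (Lp.coeFn_add _ _).trans (((hT _ _ hg₁ h₁).add (hT _ _ hg₂ h₂)).trans ?_)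
        filter_upwards with z
        simp [mul_add]
      map_smul' := by
        intro c f
        obtain ⟨g, hg, hfg⟩ := f.2
        refine bergman_ext (hT _ (c • g) (hg.const_smul c)
          ((Lp.coeFn_smul _ _).trans (hfg.const_smul c))) ?_
        refine (Lp.coeFn_smul _ _).trans (((hT _ _ hg hfg).const_smul c).trans ?_)
        filter_upwards with z
        simp [mul_left_comm] }
  refine ⟨Tl.mkContinuous (max K 0) fun f => ?_, hT⟩
  obtain ⟨g, hg, hfg⟩ := f.2
  change ‖T f‖ ≤ _
  rw [norm_eq_eLpNorm_of_ae_eq (hT f g hg hfg), norm_eq_eLpNorm_of_ae_eq hfg]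
  calc _ ≤ (ENNReal.ofReal K * eLpNorm g 2 diskArea).toReal :=
        ENNReal.toReal_mono (ENNReal.mul_ne_top ENNReal.ofReal_ne_top (memLp_of_ae_eq hfg).2.ne)
          (hK g hg)
    _ = _ := by rw [ENNReal.toReal_mul, ENNReal.toReal_ofReal']

/-- Multiplication by a bounded holomorphic function is a bounded operator. -/
theorem exists_isWeightedComposition_id {h : ℂ → ℂ} (hh : DifferentiableOn ℂ h (ball 0 1)) (K : ℝ)
    (hK : ∀ z ∈ ball (0 : ℂ) 1, ‖h z‖ ≤ K) :
    ∃ W : bergmanSpace →L[ℂ] bergmanSpace, IsWeightedComposition h id W := by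
  refine exists_isWeightedComposition hh differentiableOn_id (Set.mapsTo_id _) K fun g hg => ?_
  refine eLpNorm_le_mul_eLpNorm_of_ae_le_mul (ae_diskArea_of_forall_mem_ball fun z hz => ?_) 2
  rw [norm_mul]
  exact mul_le_mul_of_nonneg_right (hK z hz) (norm_nonneg _)

/-! ### Hyperbolic automorphisms -/

/-- The hyperbolic automorphism of the disk that fixes `1` and `-1` and takes `0` to `tanh x`. With
this parameter, composition of automorphisms becomes addition. -/
noncomputable def hypAut (x : ℝ) (z : ℂ) : ℂ :=
  (Real.cosh x * z + Real.sinh x) / (Real.sinh x * z + Real.cosh x)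

lemma two_mul_denom (x : ℝ) (z : ℂ) :
    2 * ((Real.sinh x : ℂ) * z + Real.cosh x) =
      (Real.exp x : ℝ) * (1 + z) + (Real.exp (-x) : ℝ) * (1 - z) := by
  rw [Real.sinh_eq, Real.cosh_eq]
  push_cast
  ring

/-- The mixed term in the expansion of the square is `2 * (1 - ‖z‖ ^ 2)`, which is positive on the
disk; this yields the lower bounds for the denominator of `hypAut x` near each fixed point. -/
lemma normSq_denom (x : ℝ) (z : ℂ) :
    4 * ‖(Real.sinh x : ℂ) * z + Real.cosh x‖ ^ 2 =
      Real.exp x ^ 2 * ‖1 + z‖ ^ 2 + Real.exp (-x) ^ 2 * ‖1 - z‖ ^ 2 + 2 * (1 - ‖z‖ ^ 2) := by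
  have h4 : Complex.normSq 2 = 4 := by norm_num [Complex.normSq_apply]
  have h := congrArg Complex.normSq (two_mul_denom x z)
  rw [map_mul, h4] at h
  have he : Real.exp x * Real.exp (-x) = 1 := by rw [← Real.exp_add]; simp
  simp only [← Complex.normSq_eq_norm_sq]
  rw [h]
  simp only [Complex.normSq_apply, Complex.add_re, Complex.add_im, Complex.mul_re, Complex.mul_im,
    Complex.sub_re, Complex.sub_im, Complex.one_re, Complex.one_im, Complex.ofReal_re,
    Complex.ofReal_im]
  linear_combination (2 * (1 - (z.re * z.re + z.im * z.im))) * he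

lemma exp_mul_norm_one_add_le (x : ℝ) {z : ℂ} (hz : z ∈ ball (0 : ℂ) 1) :
    Real.exp x * ‖1 + z‖ ≤ 2 * ‖(Real.sinh x : ℂ) * z + Real.cosh x‖ := by
  have hz1 : ‖z‖ < 1 := by simpa using hz
  have := normSq_denom x z
  refine abs_le_of_sq_le_sq' ?_ (by positivity) |>.2
  nlinarith [norm_nonneg z, sq_nonneg (Real.exp (-x) * ‖1 - z‖)]

lemma exp_neg_mul_norm_one_sub_le (x : ℝ) {z : ℂ} (hz : z ∈ ball (0 : ℂ) 1) :
    Real.exp (-x) * ‖1 - z‖ ≤ 2 * ‖(Real.sinh x : ℂ) * z + Real.cosh x‖ := by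
  have hz1 : ‖z‖ < 1 := by simpa using hz
  have := normSq_denom x z
  refine abs_le_of_sq_le_sq' ?_ (by positivity) |>.2
  nlinarith [norm_nonneg z, sq_nonneg (Real.exp x * ‖1 + z‖)]

lemma denom_ne_zero (x : ℝ) {z : ℂ} (hz : z ∈ ball (0 : ℂ) 1) :
    (Real.sinh x : ℂ) * z + Real.cosh x ≠ 0 := by
  intro h0
  have hz1 : ‖z‖ < 1 := by simpa using hz
  have := normSq_denom x z
  rw [h0] at this
  simp only [norm_zero] at this
  nlinarith [norm_nonneg z, sq_nonneg (Real.exp x * ‖1 + z‖), sq_nonneg (Real.exp (-x) * ‖1 - z‖)]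

lemma cosh_sq_sub_sinh_sq_complex (x : ℝ) :
    (Real.cosh x : ℂ) ^ 2 - (Real.sinh x : ℂ) ^ 2 = 1 := by
  exact_mod_cast congrArg (fun t : ℝ => (t : ℂ)) (Real.cosh_sq_sub_sinh_sq x)

lemma mapsTo_hypAut (x : ℝ) : Set.MapsTo (hypAut x) (ball 0 1) (ball 0 1) := by
  intro z hz
  have hz1 : ‖z‖ < 1 := by simpa using hz
  have hd := denom_ne_zero x hz
  rw [mem_ball_zero_iff, hypAut, norm_div, div_lt_one (norm_pos_iff.2 hd)]
  refine abs_lt_of_sq_lt_sq' ?_ (norm_nonneg _) |>.2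
  have hz2 : Complex.normSq z < 1 := by
    rw [Complex.normSq_eq_norm_sq]; nlinarith [norm_nonneg z]
  have hcs := Real.cosh_sq_sub_sinh_sq x
  simp only [← Complex.normSq_eq_norm_sq]
  simp only [Complex.normSq_apply, Complex.add_re, Complex.add_im, Complex.mul_re, Complex.mul_im,
    Complex.ofReal_re, Complex.ofReal_im] at hz2 ⊢
  nlinarith

lemma hypAut_zero (z : ℂ) : hypAut 0 z = z := by simp [hypAut]

lemma hypAut_add (x y : ℝ) {z : ℂ} (hz : z ∈ ball (0 : ℂ) 1) :
    hypAut (x + y) z = hypAut x (hypAut y z) := by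
  have h1 := denom_ne_zero (x + y) hz
  have h2 := denom_ne_zero y hz
  have h3 := denom_ne_zero x (mapsTo_hypAut y hz)
  unfold hypAut at h3 ⊢
  rw [div_eq_div_iff h1 h3, Real.sinh_add, Real.cosh_add]
  simp only [Complex.ofReal_add, Complex.ofReal_mul]
  generalize (Real.sinh y : ℂ) = b at h2 ⊢
  generalize (Real.cosh y : ℂ) = a at h2 ⊢
  field_simp
  ring

lemma hasDerivAt_hypAut (x : ℝ) {z : ℂ} (hz : z ∈ ball (0 : ℂ) 1) :
    HasDerivAt (hypAut x) (((Real.sinh x : ℂ) * z + Real.cosh x) ^ 2)⁻¹ z := by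
  have hd := denom_ne_zero x hz
  have h1 : HasDerivAt (fun z : ℂ => (Real.cosh x : ℂ) * z + Real.sinh x) (Real.cosh x) z := by
    simpa using ((hasDerivAt_id z).const_mul (Real.cosh x : ℂ)).add_const (Real.sinh x : ℂ)
  have h2 : HasDerivAt (fun z : ℂ => (Real.sinh x : ℂ) * z + Real.cosh x) (Real.sinh x) z := by
    simpa using ((hasDerivAt_id z).const_mul (Real.sinh x : ℂ)).add_const (Real.cosh x : ℂ)
  refine (h1.div h2 hd).congr_deriv ?_
  rw [← one_div]
  congr 1
  linear_combination cosh_sq_sub_sinh_sq_complex x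

lemma differentiableOn_hypAut (x : ℝ) : DifferentiableOn ℂ (hypAut x) (ball 0 1) :=
  fun _ hz => (hasDerivAt_hypAut x hz).differentiableAt.differentiableWithinAt

lemma hypAut_hypAut_neg (x : ℝ) {z : ℂ} (hz : z ∈ ball (0 : ℂ) 1) :
    hypAut x (hypAut (-x) z) = z := by
  rw [← hypAut_add x (-x) hz, add_neg_cancel, hypAut_zero]

lemma image_hypAut (x : ℝ) : hypAut x '' ball 0 1 = ball 0 1 :=
  (mapsTo_hypAut x).image_subset.antisymm fun z hz =>
    ⟨hypAut (-x) z, mapsTo_hypAut _ hz, hypAut_hypAut_neg x hz⟩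

lemma injOn_hypAut (x : ℝ) : Set.InjOn (hypAut x) (ball 0 1) := by
  intro z hz w hw h
  have := congrArg (hypAut (-x)) h
  rwa [← hypAut_add _ _ hz, ← hypAut_add _ _ hw, neg_add_cancel, hypAut_zero, hypAut_zero] at this

/-- Change of variables: the real Jacobian of a holomorphic map is the squared modulus of its
derivative. -/
theorem eLpNorm_comp_hypAut (x : ℝ) (g : ℂ → ℂ) :
    eLpNorm (fun z => g (hypAut x z)) 2 diskArea =
      eLpNorm (fun z => (((Real.sinh (-x) : ℂ) * z + Real.cosh (-x)) ^ 2)⁻¹ * g z) 2 diskArea := by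
  have key : ∀ u : ℂ → ℂ, eLpNorm u 2 diskArea =
      (∫⁻ z in ball (0 : ℂ) 1, ‖u z‖ₑ ^ 2) ^ (1 / 2 : ℝ) := by
    intro u
    rw [eLpNorm_eq_lintegral_rpow_enorm_toReal (by norm_num) (by norm_num)]
    simp [diskArea]
  rw [key, key]
  congr 1
  conv_lhs => rw [← image_hypAut (-x)]
  rw [lintegral_image_eq_lintegral_abs_det_fderiv_mul volume measurableSet_ball
    (fun z hz => ((hasDerivAt_hypAut (-x) hz).hasFDerivAt.restrictScalars ℝ).hasFDerivWithinAt)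
    (injOn_hypAut (-x))]
  refine setLIntegral_congr_fun measurableSet_ball fun z hz => ?_
  rw [hypAut_hypAut_neg x hz, enorm_mul, mul_pow]
  congr 1
  have hdet : ∀ c : ℂ, (((ContinuousLinearMap.toSpanSingleton ℂ c).restrictScalars ℝ :
      ℂ →L[ℝ] ℂ)).det = ‖c‖ ^ 2 := by
    intro c
    simp [ContinuousLinearMap.det, LinearMap.det_restrictScalars, Algebra.norm_complex_eq,
      Complex.normSq_eq_norm_sq]
  rw [hdet, abs_of_nonneg (by positivity), ENNReal.ofReal_pow (norm_nonneg _), ofReal_norm]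

lemma exp_neg_abs_le_norm_denom (x : ℝ) {z : ℂ} (hz : z ∈ ball (0 : ℂ) 1) :
    Real.exp (-|x|) ≤ ‖(Real.sinh x : ℂ) * z + Real.cosh x‖ := by
  have hz1 : ‖z‖ < 1 := by simpa using hz
  have h1 := norm_sub_le_norm_add (Real.cosh x : ℂ) ((Real.sinh x : ℂ) * z)
  rw [norm_mul, Complex.norm_real, Complex.norm_real, Real.norm_eq_abs, Real.norm_eq_abs,
    abs_of_pos (Real.cosh_pos x), Real.abs_sinh, add_comm] at h1
  have h2 : Real.sinh |x| * ‖z‖ ≤ Real.sinh |x| :=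
    mul_le_of_le_one_right (Real.sinh_nonneg_iff.2 (abs_nonneg x)) hz1.le
  rw [← Real.cosh_sub_sinh, Real.cosh_abs]
  linarith

theorem eLpNorm_comp_hypAut_le (x : ℝ) (g : ℂ → ℂ) :
    eLpNorm (fun z => g (hypAut x z)) 2 diskArea ≤
      ENNReal.ofReal (Real.exp |x| ^ 2) * eLpNorm g 2 diskArea := by
  rw [eLpNorm_comp_hypAut]
  refine eLpNorm_le_mul_eLpNorm_of_ae_le_mul (ae_diskArea_of_forall_mem_ball fun z hz => ?_) 2
  have h := exp_neg_abs_le_norm_denom (-x) hz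
  rw [abs_neg, Real.exp_neg] at h
  rw [norm_mul, norm_inv, norm_pow]
  refine mul_le_mul_of_nonneg_right ?_ (norm_nonneg _)
  rw [← inv_pow]
  exact pow_le_pow_left₀ (by positivity) (inv_le_of_inv_le₀ (by positivity) h) 2

/-- On the disk, the denominator of `hypAut x` is at least of order `exp |x|`, except near the one
fixed point at which it is small; a factor `1 - z ^ 2` compensates for this. -/
lemma exp_abs_mul_norm_one_sub_sq_le (x : ℝ) {z : ℂ} (hz : z ∈ ball (0 : ℂ) 1) :
    Real.exp |x| * ‖1 - z ^ 2‖ ≤ 4 * ‖(Real.sinh x : ℂ) * z + Real.cosh x‖ := by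
  have hz1 : ‖z‖ < 1 := by simpa using hz
  have hp : ‖1 + z‖ ≤ 2 := (norm_add_le _ _).trans (by rw [norm_one]; linarith)
  have hm : ‖1 - z‖ ≤ 2 := (norm_sub_le _ _).trans (by rw [norm_one]; linarith)
  have hf : ‖1 - z ^ 2‖ = ‖1 + z‖ * ‖1 - z‖ := by rw [← norm_mul]; ring_nf
  have h1 := exp_mul_norm_one_add_le x hz
  have h2 := exp_neg_mul_norm_one_sub_le x hz
  rw [hf]
  rcases abs_cases x with ⟨hx, -⟩ | ⟨hx, -⟩ <;> rw [hx]
  · nlinarith [norm_nonneg (1 - z), norm_nonneg (1 + z),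
      mul_nonneg (Real.exp_pos x).le (norm_nonneg (1 + z))]
  · nlinarith [norm_nonneg (1 - z), norm_nonneg (1 + z),
      mul_nonneg (Real.exp_pos (-x)).le (norm_nonneg (1 - z))]

/-- On functions that vanish to second order at both fixed points `±1`, the composition operators
decay at the same rate at which their norms grow. -/
theorem eLpNorm_comp_hypAut_le_of_vanishing (x : ℝ) (g : ℂ → ℂ) :
    eLpNorm (fun z => (1 - hypAut x z ^ 2) ^ 2 * g (hypAut x z)) 2 diskArea ≤
      ENNReal.ofReal (16 * (Real.exp |x| ^ 2)⁻¹) * eLpNorm g 2 diskArea := by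
  rw [eLpNorm_comp_hypAut x fun z => (1 - z ^ 2) ^ 2 * g z]
  refine eLpNorm_le_mul_eLpNorm_of_ae_le_mul (ae_diskArea_of_forall_mem_ball fun z hz => ?_) 2
  have h := exp_abs_mul_norm_one_sub_sq_le (-x) hz
  rw [abs_neg] at h
  have hd := norm_pos_iff.2 (denom_ne_zero (-x) hz)
  rw [← mul_assoc, norm_mul, norm_mul, norm_inv, norm_pow, norm_pow]
  refine mul_le_mul_of_nonneg_right ?_ (norm_nonneg _)
  have h2 := pow_le_pow_left₀ (by positivity) h 2
  rw [mul_pow, mul_pow] at h2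
  rw [← div_eq_mul_inv, inv_mul_le_iff₀ (by positivity), mul_div_assoc',
    le_div_iff₀ (by positivity)]
  linarith

/-! ### The group of composition operators -/

theorem exists_isWeightedComposition_hypAut (x : ℝ) :
    ∃ W : bergmanSpace →L[ℂ] bergmanSpace, IsWeightedComposition (fun _ => 1) (hypAut x) W :=
  exists_isWeightedComposition (differentiableOn_const 1) (differentiableOn_hypAut x)
    (mapsTo_hypAut x) (Real.exp |x| ^ 2) fun g _ => by
      simpa only [one_mul] using eLpNorm_comp_hypAut_le x g

/-- The composition operator of `hypAut x` on the Bergman space. -/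
noncomputable def hypComp (x : ℝ) : bergmanSpace →L[ℂ] bergmanSpace :=
  (exists_isWeightedComposition_hypAut x).choose

lemma hypComp_ae_eq (x : ℝ) {f : bergmanSpace} {g : ℂ → ℂ} (hg : DifferentiableOn ℂ g (ball 0 1))
    (hfg : ((f : Lp ℂ 2 diskArea) : ℂ → ℂ) =ᵐ[diskArea] g) :
    ((hypComp x f : Lp ℂ 2 diskArea) : ℂ → ℂ) =ᵐ[diskArea] fun z => g (hypAut x z) := by
  refine ((exists_isWeightedComposition_hypAut x).choose_spec f g hg hfg).trans ?_
  simp only [one_mul]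
  rfl

lemma differentiableOn_comp_hypAut (x : ℝ) {g : ℂ → ℂ} (hg : DifferentiableOn ℂ g (ball 0 1)) :
    DifferentiableOn ℂ (fun z => g (hypAut x z)) (ball 0 1) :=
  hg.comp (differentiableOn_hypAut x) (mapsTo_hypAut x)

lemma hypComp_zero (f : bergmanSpace) : hypComp 0 f = f := by
  obtain ⟨g, hg, hfg⟩ := f.2
  refine bergman_ext (hypComp_ae_eq 0 hg hfg) ?_
  simpa only [hypAut_zero] using hfg

lemma hypComp_add (x y : ℝ) (f : bergmanSpace) :
    hypComp (x + y) f = hypComp x (hypComp y f) := by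
  obtain ⟨g, hg, hfg⟩ := f.2
  refine bergman_ext (hypComp_ae_eq (x + y) hg hfg) ?_
  refine (hypComp_ae_eq x (differentiableOn_comp_hypAut y hg) (hypComp_ae_eq y hg hfg)).trans
    (ae_diskArea_of_forall_mem_ball fun z hz => ?_)
  simp only [add_comm x y, hypAut_add y x hz]

lemma norm_hypComp_apply_le (x : ℝ) (f : bergmanSpace) :
    ‖hypComp x f‖ ≤ Real.exp |x| ^ 2 * ‖f‖ := by
  obtain ⟨g, hg, hfg⟩ := f.2
  rw [norm_eq_eLpNorm_of_ae_eq (hypComp_ae_eq x hg hfg), norm_eq_eLpNorm_of_ae_eq hfg]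
  refine (ENNReal.toReal_mono (ENNReal.mul_ne_top ENNReal.ofReal_ne_top (memLp_of_ae_eq hfg).2.ne)
    (eLpNorm_comp_hypAut_le x g)).trans ?_
  rw [ENNReal.toReal_mul, ENNReal.toReal_ofReal (by positivity)]

/-- Functions of the form `(1 - z ^ 2) ^ 2 * g` with `g` in the Bergman space have orbits that decay
at the extremal rate, in both directions of time. -/
lemma norm_hypComp_apply_le_of_vanishing (x : ℝ) {f u : bergmanSpace} {g : ℂ → ℂ}
    (hg : DifferentiableOn ℂ g (ball 0 1))
    (hu : ((u : Lp ℂ 2 diskArea) : ℂ → ℂ) =ᵐ[diskArea] g)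
    (hf : ((f : Lp ℂ 2 diskArea) : ℂ → ℂ) =ᵐ[diskArea] fun z => (1 - z ^ 2) ^ 2 * g z) :
    ‖hypComp x f‖ ≤ 16 * (Real.exp |x| ^ 2)⁻¹ * ‖u‖ := by
  have hd : DifferentiableOn ℂ (fun z : ℂ => (1 - z ^ 2) ^ 2 * g z) (ball 0 1) :=
    DifferentiableOn.mul (by fun_prop) hg
  rw [norm_eq_eLpNorm_of_ae_eq (hypComp_ae_eq x hd hf), norm_eq_eLpNorm_of_ae_eq hu]
  refine (ENNReal.toReal_mono (ENNReal.mul_ne_top ENNReal.ofReal_ne_top (memLp_of_ae_eq hu).2.ne)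
    (eLpNorm_comp_hypAut_le_of_vanishing x g)).trans ?_
  rw [ENNReal.toReal_mul, ENNReal.toReal_ofReal (by positivity)]

/-! ### Density of the rapidly decaying functions -/

lemma one_sub_sq_re_pos {z : ℂ} (hz : z ∈ ball (0 : ℂ) 1) : 0 < (1 - z ^ 2).re := by
  have hz1 : ‖z ^ 2‖ < 1 := by
    rw [norm_pow]
    exact pow_lt_one₀ (norm_nonneg _) (by simpa using hz) two_ne_zero
  have := (Complex.re_le_norm (z ^ 2)).trans_lt hz1
  simpa using this

lemma le_norm_one_sub_sq_add {ε : ℝ} {z : ℂ} (hz : z ∈ ball (0 : ℂ) 1) :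
    ε ≤ ‖1 - z ^ 2 + ε‖ := by
  have h := one_sub_sq_re_pos hz
  refine le_trans ?_ (Complex.re_le_norm _)
  rw [Complex.add_re, Complex.ofReal_re]
  linarith

lemma norm_one_sub_sq_div_le {ε : ℝ} (hε : 0 < ε) {z : ℂ} (hz : z ∈ ball (0 : ℂ) 1) :
    ‖(1 - z ^ 2) / (1 - z ^ 2 + ε)‖ ≤ 1 := by
  have h := one_sub_sq_re_pos hz
  rw [norm_div, div_le_one (hε.trans_le (le_norm_one_sub_sq_add hz))]
  refine abs_le_of_sq_le_sq' ?_ (norm_nonneg _) |>.2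
  rw [← Complex.normSq_eq_norm_sq, ← Complex.normSq_eq_norm_sq, Complex.normSq_apply,
    Complex.normSq_apply, Complex.add_re, Complex.add_im, Complex.ofReal_re, Complex.ofReal_im]
  nlinarith [mul_pos hε h]

lemma one_sub_sq_add_ne_zero {ε : ℝ} (hε : 0 < ε) {z : ℂ} (hz : z ∈ ball (0 : ℂ) 1) :
    1 - z ^ 2 + (ε : ℂ) ≠ 0 :=
  norm_pos_iff.1 (hε.trans_le (le_norm_one_sub_sq_add hz))

/-- Multiplication by `((1 - z ^ 2) / (1 - z ^ 2 + ε)) ^ 2`, which is bounded by `1` because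
`1 - z ^ 2` has positive real part, approximates the identity as `ε → 0`. -/
theorem dense_setOf_norm_hypComp_le :
    Dense {f : bergmanSpace | ∃ K, ∀ x, ‖hypComp x f‖ ≤ K * (Real.exp |x| ^ 2)⁻¹} := by
  intro f
  obtain ⟨g, hg, hfg⟩ := f.2
  let ε : ℕ → ℝ := fun n => 1 / ((n : ℝ) + 1)
  have hε : ∀ n, 0 < ε n := fun n => by positivity
  have hε0 : Filter.Tendsto ε Filter.atTop (nhds 0) := tendsto_one_div_add_atTop_nhds_zero_nat
  have hdiff : ∀ n, DifferentiableOn ℂ (fun z : ℂ => ((1 - z ^ 2 + (ε n : ℂ)) ^ 2)⁻¹)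
      (ball 0 1) := fun n => DifferentiableOn.inv (by fun_prop)
        fun z hz => pow_ne_zero 2 (one_sub_sq_add_ne_zero (hε n) hz)
  have hex : ∀ n, ∃ W, IsWeightedComposition (fun z : ℂ => ((1 - z ^ 2 + (ε n : ℂ)) ^ 2)⁻¹) id W :=
    fun n => exists_isWeightedComposition_id (hdiff n) ((ε n ^ 2)⁻¹) fun z hz => by
      rw [norm_inv, norm_pow]
      exact inv_anti₀ (pow_pos (hε n) 2)
        (pow_le_pow_left₀ (hε n).le (le_norm_one_sub_sq_add hz) 2)
  have hex' : ∃ W, IsWeightedComposition (fun z : ℂ => (1 - z ^ 2) ^ 2) id W :=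
    exists_isWeightedComposition_id (by fun_prop) (2 ^ 2) fun z hz => by
      have hz1 : ‖z‖ < 1 := by simpa using hz
      rw [norm_pow]
      refine pow_le_pow_left₀ (norm_nonneg _) ((norm_sub_le _ _).trans ?_) 2
      rw [norm_one, norm_pow]
      nlinarith [norm_nonneg z]
  choose W hW using hex
  obtain ⟨V, hV⟩ := hex'
  have hWf := fun n => hW n f g hg hfg
  have hdW := fun n => (hdiff n).mul hg
  have hVf := fun n => hV (W n f) _ (hdW n) (hWf n)
  refine mem_closure_of_tendsto (f := fun n => V (W n f)) (b := Filter.atTop) ?_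
    (Filter.Eventually.of_forall fun n => ⟨16 * ‖W n f‖, fun x => ?_⟩)
  · have hlim : Filter.Tendsto (fun n => ∫⁻ z,
        ‖((1 - z ^ 2) ^ 2 * (((1 - z ^ 2 + (ε n : ℂ)) ^ 2)⁻¹ * g z)) - g z‖ₑ ^ (2 : ℝ) ∂diskArea)
        Filter.atTop (nhds (∫⁻ _, 0 ∂diskArea)) := by
      refine tendsto_lintegral_of_dominated_convergence' (fun z => (2 * ‖g z‖ₑ) ^ (2 : ℝ))
        (fun n => ?_) (fun n => ?_) ?_ ?_
      · have : DifferentiableOn ℂ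
            (fun z : ℂ => (1 - z ^ 2) ^ 2 * (((1 - z ^ 2 + (ε n : ℂ)) ^ 2)⁻¹ * g z) - g z)
            (ball 0 1) := (DifferentiableOn.mul (by fun_prop) (hdW n)).sub hg
        exact (aestronglyMeasurable_diskArea this).enorm.pow_const _
      · refine ae_diskArea_of_forall_mem_ball fun z hz => ?_
        refine ENNReal.rpow_le_rpow ?_ (by norm_num)
        have h1 := pow_le_one₀ (norm_nonneg _) (norm_one_sub_sq_div_le (hε n) hz) (n := 2)
        rw [norm_div, div_pow] at h1
        rw [two_mul]
        refine (enorm_sub_le).trans (add_le_add ?_ le_rfl)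
        rw [← ofReal_norm, ← ofReal_norm]
        refine ENNReal.ofReal_le_ofReal ?_
        rw [← mul_assoc, norm_mul, norm_mul, norm_inv, norm_pow, norm_pow, ← div_eq_mul_inv]
        exact mul_le_of_le_one_left (norm_nonneg _) h1
      · have h2 := lintegral_rpow_enorm_lt_top_of_eLpNorm_lt_top (by norm_num) (by norm_num)
          (memLp_of_ae_eq hfg).2
        simp only [ENNReal.toReal_ofNat] at h2
        simp_rw [ENNReal.mul_rpow_of_nonneg _ _ (show (0 : ℝ) ≤ 2 by norm_num)]
        rw [lintegral_const_mul' _ _ (by finiteness)]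
        exact ENNReal.mul_ne_top (by finiteness) h2.ne
      · refine ae_diskArea_of_forall_mem_ball fun z hz => ?_
        have hne : (1 - z ^ 2 : ℂ) ≠ 0 := fun h => by
          have := one_sub_sq_re_pos hz
          rw [h] at this
          simp at this
        have h1 : Filter.Tendsto (fun n => (1 - z ^ 2) ^ 2 *
            (((1 - z ^ 2 + (ε n : ℂ)) ^ 2)⁻¹ * g z) - g z) Filter.atTop
            (nhds ((1 - z ^ 2) ^ 2 * (((1 - z ^ 2 + ((0 : ℝ) : ℂ)) ^ 2)⁻¹ * g z) - g z)) := by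
          refine Filter.Tendsto.sub_const (Filter.Tendsto.const_mul _
            (Filter.Tendsto.mul_const _ (Filter.Tendsto.inv₀ (Filter.Tendsto.pow
              (Filter.Tendsto.const_add _ ?_) 2) (by simpa using hne)))) _
          exact (Complex.continuous_ofReal.tendsto 0).comp hε0
        rw [Complex.ofReal_zero, add_zero, ← mul_assoc,
          mul_inv_cancel₀ (pow_ne_zero 2 hne), one_mul, sub_self] at h1
        have h2 := (ENNReal.continuous_rpow_const (y := (2 : ℝ))).tendsto _ |>.comp h1.enorm
        simpa [Function.comp_def] using h2
    rw [tendsto_iff_norm_sub_tendsto_zero]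
    rw [lintegral_zero] at hlim
    have h2 := (ENNReal.continuous_rpow_const (y := (1 / 2 : ℝ))).tendsto _ |>.comp hlim
    rw [ENNReal.zero_rpow_of_pos (by norm_num)] at h2
    have h3 := (ENNReal.tendsto_toReal ENNReal.zero_ne_top).comp h2
    rw [ENNReal.toReal_zero] at h3
    convert h3 using 2 with n
    rw [norm_eq_eLpNorm_of_ae_eq (g := fun z =>
      ((1 - z ^ 2) ^ 2 * (((1 - z ^ 2 + (ε n : ℂ)) ^ 2)⁻¹ * g z)) - g z)
      ((Lp.coeFn_sub _ _).trans ((hVf n).sub hfg)),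
      eLpNorm_eq_lintegral_rpow_enorm_toReal (by norm_num) (by norm_num)]
    simp
  · have := norm_hypComp_apply_le_of_vanishing x (hdW n) (hWf n) (hVf n)
    linarith

/-! ### Intertwining operators -/

lemma hypComp_nat_mul_apply {x : ℝ} {c : ℂ} {X : bergmanSpace →L[ℂ] bergmanSpace}
    (h : (hypComp x).comp X = c • X.comp (hypComp x)) (n : ℕ) (f : bergmanSpace) :
    hypComp (n * x) (X f) = c ^ n • X (hypComp (n * x) f) := by
  induction n with
  | zero => simp [hypComp_zero]
  | succ n ih =>
    have h1 : ∀ u, hypComp x (X u) = c • X (hypComp x u) := fun u => congrArg (fun T => T u) h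
    have h2 : ((n + 1 : ℕ) : ℝ) * x = x + n * x := by push_cast; ring
    rw [h2, hypComp_add, ih, map_smul, h1, hypComp_add, smul_smul, pow_succ]

/-- The growth of the group on one side of `X` is compensated by the decay of the orbit on the other
side, so `c ^ n • X f` stays bounded, and so does `X f / c ^ n`. -/
theorem eq_zero_of_intertwining {x : ℝ} {c : ℂ} (hc : ‖c‖ ≠ 1)
    {X : bergmanSpace →L[ℂ] bergmanSpace}
    (h : (hypComp x).comp X = c • X.comp (hypComp x)) : X = 0 := by
  refine ContinuousLinearMap.ext_on
    (dense_setOf_norm_hypComp_le.mono Submodule.subset_span) ?_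
  rintro f ⟨K, hK⟩
  have hb : ∀ y, ‖hypComp y (X (hypComp (-y) f))‖ ≤ ‖X‖ * K := by
    intro y
    have h1 := hK (-y)
    rw [abs_neg] at h1
    calc _ ≤ Real.exp |y| ^ 2 * (‖X‖ * (K * (Real.exp |y| ^ 2)⁻¹)) :=
          (norm_hypComp_apply_le _ _).trans (by gcongr; exact X.le_opNorm_of_le h1)
      _ = ‖X‖ * K := by field_simp
  rw [zero_apply, ← norm_eq_zero]
  by_contra hne
  have hpos : 0 < ‖X f‖ := (norm_nonneg _).lt_of_ne' hne
  rcases hc.lt_or_gt with hlt | hgt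
  · have hle : ∀ n : ℕ, ‖X f‖ ≤ ‖c‖ ^ n * (‖X‖ * K) := by
      intro n
      have h1 := congrArg (hypComp (-(n * x))) (hypComp_nat_mul_apply h n f)
      rw [← hypComp_add, neg_add_cancel, hypComp_zero, map_smul] at h1
      have h2 := hb (-(n * x))
      rw [neg_neg] at h2
      rw [h1, norm_smul, norm_pow]
      gcongr
    have hlim := (tendsto_pow_atTop_nhds_zero_of_lt_one (norm_nonneg c) hlt).mul_const (‖X‖ * K)
    rw [zero_mul] at hlim
    exact hpos.not_ge (ge_of_tendsto' hlim hle)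
  · have hle : ∀ n : ℕ, ‖c‖ ^ n * ‖X f‖ ≤ ‖X‖ * K := by
      intro n
      have h1 := hypComp_nat_mul_apply h n (hypComp (-(n * x)) f)
      rw [← hypComp_add, add_neg_cancel, hypComp_zero] at h1
      have h2 := hb (n * x)
      rwa [h1, norm_smul, norm_pow] at h2
    obtain ⟨n, hn⟩ := pow_unbounded_of_one_lt (‖X‖ * K / ‖X f‖) hgt
    rw [div_lt_iff₀ hpos] at hn
    exact (hle n).not_gt hn

/-! ### Unimodular extended eigenvalues -/

/-- `w ↦ w ^ (i θ)` is bounded on the right half-plane, which `z ↦ (1 + z) / (1 - z)` identifies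
with the disk; in this coordinate `hypAut x` is the dilation by `exp (2 x)`. -/
noncomputable def imaginaryPower (θ : ℝ) (z : ℂ) : ℂ :=
  Complex.exp (Complex.log ((1 + z) / (1 - z)) * (Complex.I * θ))

lemma one_sub_ne_zero_of_mem_ball {z : ℂ} (hz : z ∈ ball (0 : ℂ) 1) : 1 - z ≠ 0 := by
  intro h
  rw [sub_eq_zero] at h
  simp [← h] at hz

lemma cayley_re_pos {z : ℂ} (hz : z ∈ ball (0 : ℂ) 1) : 0 < ((1 + z) / (1 - z)).re := by
  have hz2 : Complex.normSq z < 1 := by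
    rw [Complex.normSq_eq_norm_sq]
    exact pow_lt_one₀ (norm_nonneg _) (by simpa using hz) two_ne_zero
  have hn := Complex.normSq_pos.2 (one_sub_ne_zero_of_mem_ball hz)
  rw [Complex.div_re, ← add_div]
  refine div_pos ?_ hn
  simp only [Complex.normSq_apply, Complex.add_re, Complex.add_im, Complex.sub_re, Complex.sub_im,
    Complex.one_re, Complex.one_im] at hz2 ⊢
  nlinarith

lemma differentiableOn_imaginaryPower (θ : ℝ) :
    DifferentiableOn ℂ (imaginaryPower θ) (ball 0 1) := by
  refine DifferentiableOn.cexp (DifferentiableOn.mul_const (DifferentiableOn.clog ?_ ?_) _)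
  · exact DifferentiableOn.div (by fun_prop) (by fun_prop) fun z => one_sub_ne_zero_of_mem_ball
  · exact fun z hz => Or.inl (cayley_re_pos hz)

lemma norm_imaginaryPower_le (θ : ℝ) {z : ℂ} (hz : z ∈ ball (0 : ℂ) 1) :
    ‖imaginaryPower θ z‖ ≤ Real.exp (Real.pi / 2 * |θ|) := by
  rw [imaginaryPower, Complex.norm_exp, Real.exp_le_exp]
  have h := Complex.abs_arg_le_pi_div_two_iff.2 (cayley_re_pos hz).le
  have h1 : (Complex.log ((1 + z) / (1 - z)) * (Complex.I * θ)).re =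
      -(Complex.arg ((1 + z) / (1 - z)) * θ) := by
    rw [← Complex.log_im]
    simp
  rw [h1]
  refine (neg_le_abs _).trans ?_
  rw [abs_mul]
  gcongr

lemma cayley_hypAut (x : ℝ) {z : ℂ} (hz : z ∈ ball (0 : ℂ) 1) :
    (1 + hypAut x z) / (1 - hypAut x z) = (Real.exp (2 * x) : ℝ) * ((1 + z) / (1 - z)) := by
  have h1 := one_sub_ne_zero_of_mem_ball hz
  have h2 := one_sub_ne_zero_of_mem_ball (mapsTo_hypAut x hz)
  have h3 := denom_ne_zero x hz
  have he : (Real.exp (2 * x) : ℂ) * ((Real.cosh x : ℂ) - Real.sinh x) =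
      Real.cosh x + Real.sinh x := by
    rw [← Complex.ofReal_sub, ← Complex.ofReal_add, Real.cosh_sub_sinh, Real.cosh_add_sinh,
      ← Complex.ofReal_mul, ← Real.exp_add]
    ring_nf
  rw [mul_div_assoc', div_eq_div_iff h2 h1]
  unfold hypAut
  generalize (Real.sinh x : ℂ) = b at he h3 ⊢
  generalize (Real.cosh x : ℂ) = a at he h3 ⊢
  have hp : 1 + (a * z + b) / (b * z + a) = (a + b) * (1 + z) / (b * z + a) := by
    rw [eq_div_iff h3, add_mul, div_mul_cancel₀ _ h3]
    ring
  have hm : 1 - (a * z + b) / (b * z + a) = (a - b) * (1 - z) / (b * z + a) := by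
    rw [eq_div_iff h3, sub_mul, div_mul_cancel₀ _ h3]
    ring
  rw [hp, hm, ← he]
  ring

lemma imaginaryPower_hypAut (θ x : ℝ) {z : ℂ} (hz : z ∈ ball (0 : ℂ) 1) :
    imaginaryPower θ (hypAut x z) = Complex.exp ((2 * x * θ : ℝ) * Complex.I) *
      imaginaryPower θ z := by
  have hne : (1 + z) / (1 - z) ≠ 0 := fun h => by
    have := cayley_re_pos hz
    rw [h] at this
    simp at this
  rw [imaginaryPower, imaginaryPower, cayley_hypAut x hz,
    Complex.log_ofReal_mul (Real.exp_pos _) hne, Real.log_exp, ← Complex.exp_add]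
  congr 1
  push_cast
  ring

theorem mem_extendedSpectrum_hypComp_of_norm_eq_one {x : ℝ} (hx : x ≠ 0) {c : ℂ} (hc : ‖c‖ = 1) :
    c ∈ extendedSpectrum (hypComp x) := by
  -- the exponent is chosen so that the dilation factor `exp (2 x)` contributes exactly `c`
  let θ : ℝ := c.arg / (2 * x)
  have hθ : Complex.exp ((2 * x * θ : ℝ) * Complex.I) = c := by
    have h1 : 2 * x * θ = c.arg := by simp only [θ]; field_simp
    have h2 := Complex.norm_mul_exp_arg_mul_I c
    rwa [hc, Complex.ofReal_one, one_mul, ← h1] at h2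
  have hd := differentiableOn_imaginaryPower θ
  obtain ⟨X, hX⟩ := exists_isWeightedComposition_id hd _ fun z => norm_imaginaryPower_le θ
  refine ⟨X, fun h0 => ?_, ?_⟩
  · have hfin : IsFiniteMeasure diskArea := ⟨by simp [diskArea]⟩
    have hmem : MemLp (fun _ : ℂ => (1 : ℂ)) 2 diskArea := memLp_const 1
    have h1 := hX ⟨hmem.toLp _, _, differentiableOn_const 1, hmem.coeFn_toLp⟩ _
      (differentiableOn_const 1) hmem.coeFn_toLp
    rw [h0, zero_apply] at h1
    have h2 := eqOn_ball_of_ae_eq (hd.mul (differentiableOn_const 1)) (differentiableOn_const 0)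
      (h1.symm.trans (Lp.coeFn_zero ℂ 2 diskArea)) (mem_ball_self one_pos)
    simp [imaginaryPower] at h2
  · ext1 f
    obtain ⟨g, hg, hfg⟩ := f.2
    have h1 := hypComp_ae_eq x (hd.mul hg) (hX f g hg hfg)
    have h2 := hX _ _ (differentiableOn_comp_hypAut x hg) (hypComp_ae_eq x hg hfg)
    refine bergman_ext h1 ((Lp.coeFn_smul _ _).trans ((h2.const_smul c).trans
      (ae_diskArea_of_forall_mem_ball fun z hz => ?_)))
    simp only [Pi.mul_apply, Pi.smul_apply, smul_eq_mul, id]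
    rw [imaginaryPower_hypAut θ x hz, hθ, mul_assoc]

lemma hypAut_artanh {r : ℝ} (hr : r ∈ Set.Ioo (-1) 1) (z : ℂ) :
    hypAut (Real.artanh r) z = (z + r) / (1 + r * z) := by
  have hc : (Real.cosh (Real.artanh r) : ℂ) ≠ 0 :=
    Complex.ofReal_ne_zero.2 (Real.cosh_pos _).ne'
  have hs : (Real.sinh (Real.artanh r) : ℂ) = Real.cosh (Real.artanh r) * r := by
    rw [← Complex.ofReal_mul, Complex.ofReal_inj]
    nth_rw 3 [← Real.tanh_artanh hr]
    rw [Real.tanh_eq_sinh_div_cosh]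
    field_simp
  rw [hypAut, hs, ← mul_add, mul_assoc, add_comm (_ * (r * z : ℂ)), ← mul_one_add,
    mul_div_mul_left _ _ hc]

theorem theorem4p10 (r : ℝ) (hr0 : 0 < r) (hr1 : r < 1) :
    ∃ C : bergmanSpace →L[ℂ] bergmanSpace,
      IsCompositionOperator (fun z : ℂ => (z + (r : ℂ)) / (1 + (r : ℂ) * z)) C ∧
        extendedSpectrum C = Metric.sphere (0 : ℂ) 1 := by
  have hr : r ∈ Set.Ioo (-1) 1 := ⟨by linarith, hr1⟩
  have hx : Real.artanh r ≠ 0 := fun h => by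
    have := Real.tanh_artanh hr
    rw [h, Real.tanh_zero] at this
    exact hr0.ne this
  have hφ : (fun z : ℂ => (z + (r : ℂ)) / (1 + (r : ℂ) * z)) = hypAut (Real.artanh r) :=
    funext fun z => (hypAut_artanh hr z).symm
  rw [hφ]
  refine ⟨hypComp (Real.artanh r), ⟨differentiableOn_hypAut _, mapsTo_hypAut _,
    fun f g => hypComp_ae_eq _⟩, ?_⟩
  ext c
  rw [mem_sphere_zero_iff_norm]
  refine ⟨fun ⟨X, hX0, hX⟩ => ?_, mem_extendedSpectrum_hypComp_of_norm_eq_one hx⟩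
  by_contra hc
  exact hX0 (eq_zero_of_intertwining hc hX)
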